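/- Let $(\Omega,\mathcal F,\mathsf P)$ be a probability space and let $\mathcal D$ be a convex set of probability measures absolutely continuous with respect to $\mathsf P$, with $\mathsf P\in\mathcal D$. Put $\mathsf E_{\mathsf Q}X=\mathsf E_{\mathsf Q}X^+-\mathsf E_{\mathsf Q}X^-$ (with $\infty-\infty=-\infty$), $u(X)=\inf_{\mathsf Q\in\mathcal D}\mathsf E_{\mathsf Q}X$ and $\rho=-u$. Let $X=(X^1,\dots,X^d)$ be random variables with $u(X^i)>-\infty$ and $u(-X^i)>-\infty$ for all $i$, and let $H\subseteq\mathbb R^d$ be a convex cone, with $H^*=\{x:\langle h,x\rangle\ge 0\ \forall h\in H\}$. Let $G=\mathrm{cl}\{\mathsf E_{\mathsf Q}X:\mathsf Q\in\mathcal D\}$ be the generator. Define $\mathrm{RAROC}(Z)=+\infty$ if $\mathsf E_{\mathsf P}Z>0$ and $u(Z)\ge 0$, and $\mathrm{RAROC}(Z)=\mathsf E_{\mathsf P}Z/\rho(Z)$ otherwise (with $0/0=\infty/\infty=0$), and $R_*=\sup_{h\in H}\mathrm{RAROC}(\langle h,X\rangle)$. A utility allocation between $Z_1$ and $Z_2$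 is a pair $(z_1,z_2)\in\mathbb R^2$ with $z_1+z_2=u(Z_1+Z_2)$ and $az_1+bz_2\ge u(aZ_1+bZ_2)$ for all $a,b\ge 0$. Let $u^c(Z;Y)$ be the infimum of $z_1$ over all utility allocations $(z_1,z_2)$ between $Z$ and $Y-Z$. The risk contribution of $Z$ to $Y$ is $\rho^c(Z;Y)=-u^c(Z;Y)$, and the RAROC contribution of $Z$ to $Y$ is $\mathrm{RAROC}^c(Z;Y)=\mathsf E_{\mathsf P}Z/\rho^c(Z;Y)$, which is well defined if $\rho^c(Z;Y)\neq 0$. Assume that $\mathsf E_{\mathsf P}X\neq 0$ and that $G$ is strictly convex, i.e. its interior is nonempty and its border contains no nondegenerate interval. For $h\in\mathbb R^d$ write $Y=\sum_{i=1}^d h^iX^i$. **(i)** If $h\in H$, the RAROC contributions $\mathrm{RAROC}^c(h^iX^i;Y)$, $i=1,\dots,d$, are all well defined, and they are all equal and nonnegative, then $h\in\operatorname{argmax}_{g\in H}\mathrm{RAROC}(\langle g,X\rangle)$ and the common value is $R_*$. **(ii)** Conversely, assume that $0$ belongs to the relative interior of $G+H^*$. If $h$ is an interior point of $H$ and $h\in\operatorname{argmax}_{g\in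 H}\mathrm{RAROC}(\langle g,X\rangle)$, then, for every $i$, $\mathrm{RAROC}^c(h^iX^i;Y)=R_*$ if $\rho^c(h^iX^i;Y)\neq 0$, and $\mathsf E_{\mathsf P}[h^iX^i]=0$ if $\rho^c(h^iX^i;Y)=0$. In particular, all RAROC contributions that are well defined are equal. -/

import Mathlib

open MeasureTheory
open scoped Pointwise NNReal ENNReal

noncomputable section

namespace CoherentRisk

/-- The expectation `E_Q X = E_Q X⁺ - E_Q X⁻` with values in `[-∞, ∞]` and the convention
`∞ - ∞ = -∞` (which is the convention of `EReal`). -/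
def expect {Ω : Type*} [MeasurableSpace Ω] (Q : Measure Ω) (X : Ω → ℝ) : EReal :=
  ((∫⁻ ω, ENNReal.ofReal (X ω) ∂Q : ℝ≥0∞) : EReal) -
    ((∫⁻ ω, ENNReal.ofReal (-X ω) ∂Q : ℝ≥0∞) : EReal)

/-- The coherent utility `u(X) = inf_{Q ∈ D} E_Q X`. -/
def utility {Ω : Type*} [MeasurableSpace Ω] (D : Set (Measure Ω)) (X : Ω → ℝ) : EReal :=
  ⨅ Q ∈ D, expect Q X

/-- The coherent risk `ρ(X) = -u(X)`. -/
def risk {Ω : Type*} [MeasurableSpace Ω] (D : Set (Measure Ω)) (X : Ω → ℝ) : EReal :=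
  -utility D X

/-- The weak `L¹`-space of `D`: random variables with `u(X) > -∞` and `u(-X) > -∞`. -/
def MemWeakL1 {Ω : Type*} [MeasurableSpace Ω] (P : Measure Ω) (D : Set (Measure Ω))
    (X : Ω → ℝ) : Prop :=
  AEMeasurable X P ∧ ⊥ < utility D X ∧ ⊥ < utility D (fun ω => -X ω)

/-- `RAROC(X) = +∞` if `E_P X > 0` and `u(X) ≥ 0`, and `E_P X / ρ(X)` otherwise, with
`0/0 = 0` and `∞/∞ = 0` (which are the conventions of `EReal`). -/
def raroc {Ω : Type*} [MeasurableSpace Ω] (P : Measure Ω) (D : Set (Measure Ω))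
    (X : Ω → ℝ) : EReal :=
  open Classical in
  if 0 < expect P X ∧ 0 ≤ utility D X then ⊤ else expect P X / risk D X

/-- `(x₁, x₂)` is a utility allocation between `X₁` and `X₂`: the total `u(X₁ + X₂)` is shared
out, and every portfolio with nonnegative weights is allotted at least its own utility. -/
def IsUtilityAllocation {Ω : Type*} [MeasurableSpace Ω] (D : Set (Measure Ω))
    (X₁ X₂ : Ω → ℝ) (x₁ x₂ : ℝ) : Prop :=
  ((x₁ + x₂ : ℝ) : EReal) = utility D (fun ω => X₁ ω + X₂ ω) ∧
    ∀ a b : ℝ, 0 ≤ a → 0 ≤ b →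
      utility D (fun ω => a * X₁ ω + b * X₂ ω) ≤ ((a * x₁ + b * x₂ : ℝ) : EReal)

/-- The utility contribution `u^c(X; Y)` of `X` to `Y`: the least amount that a utility
allocation between `X` and `Y - X` assigns to `X`. -/
def utilityContribution {Ω : Type*} [MeasurableSpace Ω] (D : Set (Measure Ω))
    (X Y : Ω → ℝ) : EReal :=
  sInf {x : EReal | ∃ x₁ x₂ : ℝ, x = (x₁ : EReal) ∧
    IsUtilityAllocation D X (fun ω => Y ω - X ω) x₁ x₂}

/-- The risk contribution `ρ^c(X; Y) = -u^c(X; Y)`. -/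
def riskContribution {Ω : Type*} [MeasurableSpace Ω] (D : Set (Measure Ω))
    (X Y : Ω → ℝ) : EReal :=
  -utilityContribution D X Y

/-- The RAROC contribution `E_P X / ρ^c(X; Y)`; meaningful only if `ρ^c(X; Y) ≠ 0`. -/
def rarocContribution {Ω : Type*} [MeasurableSpace Ω] (P : Measure Ω) (D : Set (Measure Ω))
    (X Y : Ω → ℝ) : EReal :=
  expect P X / riskContribution D X Y

/-- The random variable `⟨h, X⟩ = ∑ hⁱ Xⁱ`. -/
def portfolio {Ω : Type*} {d : ℕ} (h : EuclideanSpace ℝ (Fin d)) (X : Fin d → Ω → ℝ) : Ω → ℝ :=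
  fun ω => ∑ i, h i * X i ω

/-- The random variable `hⁱ Xⁱ`. -/
def unit {Ω : Type*} {d : ℕ} (h : EuclideanSpace ℝ (Fin d)) (X : Fin d → Ω → ℝ) (i : Fin d) :
    Ω → ℝ :=
  fun ω => h i * X i ω

/-- The generator `G = cl {E_Q X : Q ∈ D}`. -/
def generator {Ω : Type*} [MeasurableSpace Ω] {d : ℕ} (D : Set (Measure Ω))
    (X : Fin d → Ω → ℝ) : Set (EuclideanSpace ℝ (Fin d)) :=
  closure {x | ∃ Q ∈ D, ∀ i, (x i : EReal) = expect Q (X i)}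

/-- A set is strictly convex (in the sense used for generators) if its interior is nonempty and
its border contains no nondegenerate interval. -/
def IsStrictlyConvexBody {d : ℕ} (G : Set (EuclideanSpace ℝ (Fin d))) : Prop :=
  (interior G).Nonempty ∧ ∀ x y, x ≠ y → ¬ segment ℝ x y ⊆ frontier G

/-- The dual cone `H* = {x : ∀ h ∈ H, ⟨h, x⟩ ≥ 0}`. -/
def dualCone {d : ℕ} (H : Set (EuclideanSpace ℝ (Fin d))) : Set (EuclideanSpace ℝ (Fin d)) :=
  {x | ∀ h ∈ H, 0 ≤ inner ℝ h x}

/-- `R_* = sup_{h ∈ H} RAROC(⟨h, X⟩)`. -/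
def optimalRaroc {Ω : Type*} [MeasurableSpace Ω] {d : ℕ} (P : Measure Ω) (D : Set (Measure Ω))
    (X : Fin d → Ω → ℝ) (H : Set (EuclideanSpace ℝ (Fin d))) : EReal :=
  ⨆ h ∈ H, raroc P D (portfolio h X)

/-- `argmax_{h ∈ H} RAROC(⟨h, X⟩)`. -/
def rarocArgmax {Ω : Type*} [MeasurableSpace Ω] {d : ℕ} (P : Measure Ω) (D : Set (Measure Ω))
    (X : Fin d → Ω → ℝ) (H : Set (EuclideanSpace ℝ (Fin d))) :
    Set (EuclideanSpace ℝ (Fin d)) :=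
  {h | h ∈ H ∧ ∀ g ∈ H, raroc P D (portfolio g X) ≤ raroc P D (portfolio h X)}

end CoherentRisk

end

/-! Under each `Q ∈ D` the variables are integrable, so `E_Q⟨h, X⟩ = ⟨h, E_Q X⟩` and `u(⟨h, X⟩)` is
the minimum of `⟨h, ·⟩` over the compact convex set `G`. For `h ≠ 0`, strict convexity makes the
minimiser `x` unique. This minimum is then differentiable at `h` with gradient `x`, so the utility
contribution of `hⁱXⁱ` is `hⁱxⁱ` (`utilityContribution_unit`). With `m = E_P X`, the RAROC
contributions are `hⁱmⁱ / -(hⁱxⁱ)`, and both parts turn on the relation `m = -R x`.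

(i) Equal contributions give `m = -R x`, and `R > 0` since `m ≠ 0`. As `x ∈ G`, `u(⟨g, X⟩) ≤ ⟨g, x⟩
= -⟨g, m⟩ / R` for every `g`, which bounds each RAROC by `R`, with equality at `h`
(`raroc_le_and_eq_of_mean_eq`).

(ii) The condition on `0` makes `u(⟨g, X⟩) < 0` for nonzero `g ∈ H`. Optimality then says that `⟨g,
m⟩ + R u(⟨g, X⟩)` has a local maximum, equal to zero, at the interior point `h`; the first-order
condition is `m = -R x` (`eq_neg_smul_of_eventually_le`). -/

namespace CoherentRisk

/-! ### Linear functionals on compact and strictly convex sets -/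

section Geometry

variable {E : Type*} [NormedAddCommGroup E] [InnerProductSpace ℝ E]

/-- A compact set has a lower bound on the rate at which the minimum of a linear functional
changes, provided the minimiser is unique. -/
theorem exists_inner_add_smul_lower_bound {K : Set E} (hK : IsCompact K) {h x₀ : E}
    (hmin : ∀ y ∈ K, inner ℝ h x₀ ≤ inner ℝ h y)
    (huniq : ∀ y ∈ K, inner ℝ h y = inner ℝ h x₀ → y = x₀) (v : E) {ε : ℝ} (hε : 0 < ε) :
    ∃ δ > 0, ∀ t, 0 < t → t ≤ δ → ∀ y ∈ K,
      inner ℝ h x₀ + t * (inner ℝ v x₀ - ε) ≤ inner ℝ h y + t * inner ℝ v y := by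
  have hcont : ∀ w : E, Continuous fun y : E => (inner ℝ w y : ℝ) := fun w => by fun_prop
  -- Only points of `C` can violate the bound. `C` is compact and misses `x₀`, so `h` has a positive
  -- gap there, which outweighs the bounded drop of `t * ⟨v, ·⟩` for small `t`.
  set C := K ∩ {y | inner ℝ v y ≤ inner ℝ v x₀ - ε} with hC
  have hCc : IsCompact C := hK.inter_right (isClosed_le (hcont v) continuous_const)
  have hfar : ∀ y ∈ K, y ∉ C → ∀ t : ℝ, 0 < t →
      inner ℝ h x₀ + t * (inner ℝ v x₀ - ε) ≤ inner ℝ h y + t * inner ℝ v y := by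
    intro y hy hyC t ht
    have h1 : inner ℝ v x₀ - ε ≤ inner ℝ v y := by
      by_contra hlt
      exact hyC ⟨hy, (not_le.1 hlt).le⟩
    exact add_le_add (hmin y hy) (mul_le_mul_of_nonneg_left h1 ht.le)
  rcases C.eq_empty_or_nonempty with hCe | hCn
  · exact ⟨1, one_pos, fun t ht _ y hy => hfar y hy (by simp [hCe]) t ht⟩
  · obtain ⟨p, hp, hpmin⟩ := hCc.exists_isMinOn hCn (hcont h).continuousOn
    obtain ⟨q, hq, hqmin⟩ := hCc.exists_isMinOn hCn (hcont v).continuousOn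
    have hgap : 0 < inner ℝ h p - inner ℝ h x₀ := by
      refine sub_pos.2 (lt_of_le_of_ne (hmin p hp.1) fun heq => ?_)
      have h2 : inner ℝ v p ≤ inner ℝ v x₀ - ε := hp.2
      rw [huniq p hp.1 heq.symm] at h2
      linarith
    set B : ℝ := |inner ℝ v x₀ - ε - inner ℝ v q| + 1
    have hB : 0 < B := by positivity
    refine ⟨(inner ℝ h p - inner ℝ h x₀) / B, div_pos hgap hB, fun t ht htδ y hy => ?_⟩
    by_cases hyC : y ∈ C
    · have h1 : (inner ℝ h p : ℝ) ≤ inner ℝ h y := hpmin hyC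
      have h2 : (inner ℝ v q : ℝ) ≤ inner ℝ v y := hqmin hyC
      have h3 : t * B ≤ inner ℝ h p - inner ℝ h x₀ := (le_div_iff₀ hB).1 htδ
      have h4 : t * (inner ℝ v x₀ - ε - inner ℝ v q) ≤ t * B :=
        mul_le_mul_of_nonneg_left ((le_abs_self _).trans (by simp [B])) ht.le
      have h5 := mul_le_mul_of_nonneg_left h2 ht.le
      linarith
    · exact hfar y hy hyC t ht

/-- From an interior point, a small step along `-h` would stay in `K` and lower `⟨h, ·⟩`. -/
theorem mem_frontier_of_isMin_inner {K : Set E} {h z : E} (hh : h ≠ 0) (hz : z ∈ K)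
    (hmin : ∀ y ∈ K, inner ℝ h z ≤ inner ℝ h y) : z ∈ frontier K := by
  refine ⟨subset_closure hz, fun hint => ?_⟩
  have hlim : Filter.Tendsto (fun t : ℝ => z - t • h) (nhdsWithin 0 (Set.Ioi 0)) (nhds z) := by
    have : Continuous fun t : ℝ => z - t • h := by fun_prop
    simpa using (this.tendsto 0).mono_left nhdsWithin_le_nhds
  obtain ⟨t, htK, ht⟩ := ((hlim.eventually (mem_interior_iff_mem_nhds.1 hint)).and
    self_mem_nhdsWithin).exists
  have h1 := hmin _ htK
  rw [inner_sub_right, inner_smul_right] at h1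
  have h2 : 0 < t * inner ℝ h h := mul_pos ht (real_inner_self_pos.2 hh)
  linarith

/-- On a convex set whose frontier contains no segment, a nonzero linear functional has at most
one minimiser. -/
theorem eq_of_isMin_inner {K : Set E} (hK : Convex ℝ K)
    (hs : ∀ x y, x ≠ y → ¬ segment ℝ x y ⊆ frontier K) {h x y : E} (hh : h ≠ 0)
    (hx : x ∈ K) (hy : y ∈ K) (hmin : ∀ z ∈ K, inner ℝ h x ≤ inner ℝ h z)
    (hxy : inner ℝ h y = inner ℝ h x) : y = x := by
  by_contra hne
  refine hs y x hne fun z hz => mem_frontier_of_isMin_inner hh (hK.segment_subset hy hx hz) ?_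
  obtain ⟨a, b, -, -, hab, rfl⟩ := hz
  have : inner ℝ h (a • y + b • x) = inner ℝ h x := by
    rw [inner_add_right, inner_smul_right, inner_smul_right, hxy, ← add_mul, hab, one_mul]
  rwa [this]

theorem mem_interior_of_mem_intrinsicInterior {s : Set E} {x : E} (hs : (interior s).Nonempty)
    (hx : x ∈ intrinsicInterior ℝ s) : x ∈ interior s := by
  have hspan : affineSpan ℝ s = ⊤ := affineSpan_eq_top_of_nonempty_interior
    (hs.mono (interior_mono (subset_convexHull ℝ s)))
  obtain ⟨y, hy, rfl⟩ := mem_intrinsicInterior.1 hx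
  have hopen : IsOpen ((affineSpan ℝ s : AffineSubspace ℝ E) : Set E) := by
    rw [hspan]; exact isOpen_univ
  rw [mem_interior]
  exact ⟨_, Set.image_subset_iff.2 interior_subset,
    hopen.isOpenMap_subtype_val _ isOpen_interior, y, hy, rfl⟩

end Geometry

/-! ### Integrability and uniform bounds from finite utilities -/

section Expectation

variable {Ω : Type*} [MeasurableSpace Ω]

theorem expect_eq_integral {Q : Measure Ω} {X : Ω → ℝ} (hX : Integrable X Q) :
    expect Q X = ((∫ ω, X ω ∂Q : ℝ) : EReal) := by
  have h1 : ∫⁻ ω, ENNReal.ofReal (X ω) ∂Q ≠ ⊤ := hX.lintegral_lt_top.ne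
  have h2 : ∫⁻ ω, ENNReal.ofReal (-X ω) ∂Q ≠ ⊤ := hX.neg.lintegral_lt_top.ne
  rw [integral_eq_lintegral_pos_part_sub_lintegral_neg_part hX, EReal.coe_sub,
    EReal.coe_ennreal_toReal h1, EReal.coe_ennreal_toReal h2, expect]

theorem lintegral_neg_ne_top_of_bot_lt_expect {Q : Measure Ω} {X : Ω → ℝ}
    (hX : ⊥ < expect Q X) : ∫⁻ ω, ENNReal.ofReal (-X ω) ∂Q ≠ ⊤ := by
  intro htop
  rw [expect, htop, EReal.coe_ennreal_top, EReal.sub_top] at hX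
  exact lt_irrefl _ hX

/-- Since `∞ - ∞ = -∞`, finiteness of `u(X)` and `u(-X)` from below forces both the negative and the
positive part of `X` to have finite `Q`-integral. -/
theorem MemWeakL1.integrable {P Q : Measure Ω} {D : Set (Measure Ω)} {X : Ω → ℝ}
    (hX : MemWeakL1 P D X) (hQ : Q ∈ D) (hQP : Q ≪ P) : Integrable X Q := by
  have h1 := lintegral_neg_ne_top_of_bot_lt_expect (hX.2.1.trans_le (iInf₂_le Q hQ))
  have h2 := lintegral_neg_ne_top_of_bot_lt_expect (hX.2.2.trans_le (iInf₂_le Q hQ))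
  simp only [neg_neg] at h2
  refine ⟨(hX.1.mono_ac hQP).aestronglyMeasurable, ?_⟩
  rw [hasFiniteIntegral_iff_norm]
  have hm : AEMeasurable (fun ω => ENNReal.ofReal (X ω)) Q := (hX.1.mono_ac hQP).ennreal_ofReal
  calc ∫⁻ ω, ENNReal.ofReal ‖X ω‖ ∂Q
      ≤ ∫⁻ ω, (ENNReal.ofReal (X ω) + ENNReal.ofReal (-X ω)) ∂Q := by
        refine lintegral_mono fun ω => ?_
        rcases abs_cases (X ω) with h | h
        · rw [Real.norm_eq_abs, h.1]; exact le_self_add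
        · rw [Real.norm_eq_abs, h.1]; exact le_add_self
    _ = _ := lintegral_add_left' hm _
    _ < ⊤ := ENNReal.add_lt_top.2 ⟨h2.lt_top, h1.lt_top⟩

theorem exists_lt_integral_of_bot_lt_utility {D : Set (Measure Ω)} {X : Ω → ℝ}
    (hX : ∀ Q ∈ D, Integrable X Q) (hu : ⊥ < utility D X) :
    ∃ c : ℝ, ∀ Q ∈ D, c < ∫ ω, X ω ∂Q := by
  obtain ⟨c, -, hc⟩ := EReal.lt_iff_exists_real_btwn.1 hu
  refine ⟨c, fun Q hQ => EReal.coe_lt_coe_iff.1 (hc.trans_le ?_)⟩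
  rw [← expect_eq_integral (hX Q hQ)]
  exact iInf₂_le Q hQ

theorem MemWeakL1.exists_abs_integral_le {P : Measure Ω} {D : Set (Measure Ω)} {X : Ω → ℝ}
    (hX : MemWeakL1 P D X) (hD : ∀ Q ∈ D, Q ≪ P) : ∃ C : ℝ, ∀ Q ∈ D, |∫ ω, X ω ∂Q| ≤ C := by
  have hint : ∀ Q ∈ D, Integrable X Q := fun Q hQ => hX.integrable hQ (hD Q hQ)
  obtain ⟨a, ha⟩ := exists_lt_integral_of_bot_lt_utility hint hX.2.1
  obtain ⟨b, hb⟩ := exists_lt_integral_of_bot_lt_utility (fun Q hQ => (hint Q hQ).neg) hX.2.2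
  refine ⟨max (-a) (-b), fun Q hQ => abs_le.2 ⟨?_, ?_⟩⟩
  · have := ha Q hQ
    have := le_max_left (-a) (-b)
    linarith
  · have h1 := hb Q hQ
    simp only [Pi.neg_apply, integral_neg] at h1
    have := le_max_right (-a) (-b)
    linarith

end Expectation

/-! ### The generator and utility as a minimum over it -/

section MeanVector

variable {Ω : Type*} [MeasurableSpace Ω] {d : ℕ}

/-- The vector `E_Q X` of expectations. -/
noncomputable def meanVector (X : Fin d → Ω → ℝ) (Q : Measure Ω) : EuclideanSpace ℝ (Fin d) :=
  WithLp.toLp 2 fun i => ∫ ω, X i ω ∂Q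

theorem expect_portfolio {X : Fin d → Ω → ℝ} {Q : Measure Ω} (hX : ∀ i, Integrable (X i) Q)
    (h : EuclideanSpace ℝ (Fin d)) :
    expect Q (portfolio h X) = ((inner ℝ h (meanVector X Q) : ℝ) : EReal) := by
  have hint : Integrable (portfolio h X) Q :=
    integrable_finsetSum _ fun i _ => (hX i).const_mul (h i)
  rw [expect_eq_integral hint]
  congr 1
  unfold portfolio
  rw [integral_finsetSum _ fun i _ => (hX i).const_mul (h i), PiLp.inner_apply]
  refine Finset.sum_congr rfl fun i _ => ?_
  rw [integral_const_mul]
  simp [meanVector, mul_comm]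

theorem generator_eq_closure_image {D : Set (Measure Ω)} {X : Fin d → Ω → ℝ}
    (hX : ∀ Q ∈ D, ∀ i, Integrable (X i) Q) : generator D X = closure (meanVector X '' D) := by
  unfold generator
  congr 1
  ext x
  constructor
  · rintro ⟨Q, hQ, hx⟩
    refine ⟨Q, hQ, ?_⟩
    ext i
    have := hx i
    rw [expect_eq_integral (hX Q hQ i), EReal.coe_eq_coe_iff] at this
    simpa [meanVector] using this.symm
  · rintro ⟨Q, hQ, rfl⟩
    exact ⟨Q, hQ, fun i => (expect_eq_integral (hX Q hQ i)).symm⟩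

theorem convex_image_meanVector {D : Set (Measure Ω)} (hD : Convex ℝ≥0 D) {X : Fin d → Ω → ℝ}
    (hX : ∀ Q ∈ D, ∀ i, Integrable (X i) Q) : Convex ℝ (meanVector X '' D) := by
  rintro _ ⟨Q, hQ, rfl⟩ _ ⟨R, hR, rfl⟩ a b ha hb hab
  lift a to ℝ≥0 using ha
  lift b to ℝ≥0 using hb
  refine ⟨a • Q + b • R, hD hQ hR zero_le zero_le (by exact_mod_cast hab), ?_⟩
  ext i
  simp only [meanVector, PiLp.add_apply, PiLp.smul_apply, smul_eq_mul]
  rw [integral_add_measure ((hX Q hQ i).smul_measure_nnreal) ((hX R hR i).smul_measure_nnreal),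
    integral_smul_nnreal_measure, integral_smul_nnreal_measure]
  rfl

theorem isCompact_generator {P : Measure Ω} {D : Set (Measure Ω)} {X : Fin d → Ω → ℝ}
    (hD : ∀ Q ∈ D, Q ≪ P) (hX : ∀ i, MemWeakL1 P D (X i)) : IsCompact (generator D X) := by
  rw [generator_eq_closure_image fun Q hQ i => (hX i).integrable hQ (hD Q hQ)]
  refine Bornology.IsBounded.isCompact_closure ?_
  choose C hC using fun i => (hX i).exists_abs_integral_le hD
  have hpi : Bornology.IsBounded (Set.univ.pi fun i : Fin d => Set.Icc (-C i) (C i)) :=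
    Bornology.IsBounded.pi fun i => Metric.isBounded_Icc _ _
  refine ((PiLp.antilipschitzWith_ofLp 2 (fun _ : Fin d => ℝ)).isBounded_preimage hpi).subset ?_
  rintro _ ⟨Q, hQ, rfl⟩ i -
  exact abs_le.1 (hC i Q hQ)

theorem utility_portfolio_eq {D : Set (Measure Ω)} {X : Fin d → Ω → ℝ}
    (hX : ∀ Q ∈ D, ∀ i, Integrable (X i) Q) {h x : EuclideanSpace ℝ (Fin d)}
    (hx : x ∈ generator D X) (hmin : ∀ y ∈ generator D X, inner ℝ h x ≤ inner ℝ h y) :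
    utility D (portfolio h X) = ((inner ℝ h x : ℝ) : EReal) := by
  rw [generator_eq_closure_image hX] at hx hmin
  refine le_antisymm ?_ (le_iInf₂ fun Q hQ => ?_)
  -- The minimiser may lie only in the closure, attained by no `Q`; the inequality is a closed
  -- condition, so it extends there.
  · have hclosed : IsClosed {y : EuclideanSpace ℝ (Fin d) |
        utility D (portfolio h X) ≤ ((inner ℝ h y : ℝ) : EReal)} :=
      isClosed_le continuous_const (continuous_coe_real_ereal.comp (by fun_prop))
    refine hclosed.closure_subset_iff.2 ?_ hx
    rintro _ ⟨Q, hQ, rfl⟩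
    rw [Set.mem_ofPred_eq, ← expect_portfolio (hX Q hQ)]
    exact iInf₂_le Q hQ
  · rw [expect_portfolio (hX Q hQ), EReal.coe_le_coe_iff]
    exact hmin _ (subset_closure ⟨Q, hQ, rfl⟩)

end MeanVector


/-! ### Utility contributions, RAROC and optimality -/

section Contribution

variable {Ω : Type*} [MeasurableSpace Ω] {d : ℕ}

theorem utilityContribution_eq_of_isLeast {D : Set (Measure Ω)} {X Y : Ω → ℝ} {z z' : ℝ}
    (hz : IsUtilityAllocation D X (fun ω => Y ω - X ω) z z')
    (hle : ∀ x₁ x₂, IsUtilityAllocation D X (fun ω => Y ω - X ω) x₁ x₂ → z ≤ x₁) :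
    utilityContribution D X Y = (z : EReal) := by
  refine le_antisymm (sInf_le ⟨z, z', rfl, hz⟩) (le_sInf ?_)
  rintro _ ⟨x₁, x₂, rfl, hx⟩
  exact EReal.coe_le_coe_iff.2 (hle x₁ x₂ hx)

/-- The portfolio with the `i`-th position of `h` scaled by `a` and all others by `b`. -/
noncomputable def reweight (h : EuclideanSpace ℝ (Fin d)) (i : Fin d) (a b : ℝ) :
    EuclideanSpace ℝ (Fin d) :=
  b • h + (a - b) • EuclideanSpace.single i (h i)

theorem inner_single_apply (h x : EuclideanSpace ℝ (Fin d)) (i : Fin d) :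
    (inner ℝ (EuclideanSpace.single i (h i)) x : ℝ) = h i * x i := by
  simp [EuclideanSpace.inner_single_left]

theorem inner_reweight (h x : EuclideanSpace ℝ (Fin d)) (i : Fin d) (a b : ℝ) :
    (inner ℝ (reweight h i a b) x : ℝ) = a * (h i * x i) + b * (inner ℝ h x - h i * x i) := by
  rw [reweight, inner_add_left, real_inner_smul_left, real_inner_smul_left, inner_single_apply]
  ring

theorem portfolio_reweight {Ω : Type*} (h : EuclideanSpace ℝ (Fin d)) (X : Fin d → Ω → ℝ) (i : Fin d)
    (a b : ℝ) : portfolio (reweight h i a b) X =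
      fun ω => a * unit h X i ω + b * (portfolio h X ω - unit h X i ω) := by
  funext ω
  have h1 : ∑ j, (EuclideanSpace.single i (h i) : EuclideanSpace ℝ (Fin d)) j * X j ω =
      h i * X i ω := by
    rw [Finset.sum_eq_single i] <;> simp +contextual
  simp only [portfolio, reweight, unit, PiLp.add_apply, PiLp.smul_apply, smul_eq_mul, add_mul,
    Finset.sum_add_distrib, mul_assoc, ← Finset.mul_sum, h1]
  ring

variable {P : Measure Ω} {D : Set (Measure Ω)} {X : Fin d → Ω → ℝ}

theorem isUtilityAllocation_of_isMin (hX : ∀ Q ∈ D, ∀ i, Integrable (X i) Q)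
    (hG : IsCompact (generator D X)) {h x : EuclideanSpace ℝ (Fin d)}
    (hx : x ∈ generator D X) (hmin : ∀ y ∈ generator D X, inner ℝ h x ≤ inner ℝ h y) (i : Fin d) :
    IsUtilityAllocation D (unit h X i) (fun ω => portfolio h X ω - unit h X i ω)
      (h i * x i) (inner ℝ h x - h i * x i) := by
  constructor
  · simp only [add_sub_cancel]
    exact (utility_portfolio_eq hX hx hmin).symm
  · intro a b _ _
    rw [← portfolio_reweight]
    obtain ⟨y, hy, hymin⟩ := hG.exists_isMinOn ⟨x, hx⟩
      (f := fun y => (inner ℝ (reweight h i a b) y : ℝ)) (by fun_prop)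
    rw [utility_portfolio_eq hX hy fun z hz => hymin hz, EReal.coe_le_coe_iff, ← inner_reweight]
    exact hymin hx

/-- If `⟨h, ·⟩` has a unique minimiser `x` on the generator, then the utility contribution of
`hⁱ Xⁱ` to the portfolio `h` is `hⁱ xⁱ`. -/
theorem utilityContribution_unit (hX : ∀ Q ∈ D, ∀ i, Integrable (X i) Q)
    (hG : IsCompact (generator D X)) {h x : EuclideanSpace ℝ (Fin d)}
    (hx : x ∈ generator D X) (hmin : ∀ y ∈ generator D X, inner ℝ h x ≤ inner ℝ h y)
    (huniq : ∀ y ∈ generator D X, inner ℝ h y = inner ℝ h x → y = x) (i : Fin d) :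
    utilityContribution D (unit h X i) (portfolio h X) = ((h i * x i : ℝ) : EReal) := by
  refine utilityContribution_eq_of_isLeast (isUtilityAllocation_of_isMin hX hG hx hmin i) ?_
  rintro z₁ z₂ ⟨hsum, hle⟩
  simp only [add_sub_cancel] at hsum
  rw [utility_portfolio_eq hX hx hmin, EReal.coe_eq_coe_iff] at hsum
  refine le_of_forall_pos_le_add fun ε hε => ?_
  obtain ⟨t, ht, hbound⟩ := exists_inner_add_smul_lower_bound hG hmin huniq
    (EuclideanSpace.single i (h i)) hε
  obtain ⟨y, hy, hymin⟩ := hG.exists_isMinOn ⟨x, hx⟩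
    (f := fun y => (inner ℝ (reweight h i (1 + t) 1) y : ℝ)) (by fun_prop)
  -- These weights perturb `h` by `t` in the direction `hⁱeᵢ`; the allocation bounds the resulting
  -- utility above, the rate estimate bounds it below.
  have h1 := hle (1 + t) 1 (by linarith) zero_le_one
  rw [← portfolio_reweight, utility_portfolio_eq hX hy fun z hz => hymin hz,
    EReal.coe_le_coe_iff, inner_reweight] at h1
  have h2 := hbound t ht le_rfl y hy
  rw [inner_single_apply, inner_single_apply] at h2
  have h3 : t * (h i * x i) ≤ t * (z₁ + ε) := by linarith
  exact le_of_mul_le_mul_left h3 ht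

/-- At `h = 0` minimisers need not be unique, so the derivative argument is replaced by testing an
allocation with weights `(1, 0)`. -/
theorem utilityContribution_unit_zero (hX : ∀ Q ∈ D, ∀ i, Integrable (X i) Q)
    (hG : IsCompact (generator D X)) (hne : (generator D X).Nonempty) (i : Fin d) :
    utilityContribution D (unit (0 : EuclideanSpace ℝ (Fin d)) X i) (portfolio 0 X) = 0 := by
  obtain ⟨x, hx⟩ := hne
  have hmin : ∀ y ∈ generator D X,
      inner ℝ (0 : EuclideanSpace ℝ (Fin d)) x ≤ inner ℝ 0 y := by simp
  have halloc := isUtilityAllocation_of_isMin hX hG hx hmin i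
  rw [← EReal.coe_zero, utilityContribution_eq_of_isLeast (z := 0) (by simpa using halloc)]
  rintro z₁ z₂ ⟨-, hle⟩
  have h1 := hle 1 0 zero_le_one le_rfl
  rw [← portfolio_reweight, show reweight (0 : EuclideanSpace ℝ (Fin d)) i 1 0 = 0 by
    simp [reweight], utility_portfolio_eq hX hx hmin, EReal.coe_le_coe_iff] at h1
  simpa using h1

theorem expect_unit {Q : Measure Ω} (hX : ∀ i, Integrable (X i) Q)
    (h : EuclideanSpace ℝ (Fin d)) (i : Fin d) :
    expect Q (unit h X i) = ((h i * meanVector X Q i : ℝ) : EReal) := by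
  unfold unit
  rw [expect_eq_integral ((hX i).const_mul (h i)), integral_const_mul]
  rfl

/-- `hlt` rules out the branch with value `⊤`; a zero denominator gives `0` in `ℝ` and in `EReal`
alike. -/
theorem raroc_portfolio (hX : ∀ Q ∈ D, ∀ i, Integrable (X i) Q) (hP : P ∈ D)
    {g y : EuclideanSpace ℝ (Fin d)} (hy : y ∈ generator D X)
    (hmin : ∀ z ∈ generator D X, inner ℝ g y ≤ inner ℝ g z)
    (hlt : 0 < inner ℝ g (meanVector X P) → inner ℝ g y < 0) :
    raroc P D (portfolio g X) =
      ((inner ℝ g (meanVector X P) / -inner ℝ g y : ℝ) : EReal) := by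
  unfold raroc risk
  rw [expect_portfolio (hX P hP), utility_portfolio_eq hX hy hmin, if_neg]
  · rw [← EReal.coe_neg, EReal.coe_div]
  · rintro ⟨h1, h2⟩
    exact (hlt (EReal.coe_pos.1 h1)).not_ge (EReal.coe_nonneg.1 h2)

theorem rarocContribution_unit (hX : ∀ Q ∈ D, ∀ i, Integrable (X i) Q) (hP : P ∈ D)
    {h : EuclideanSpace ℝ (Fin d)} {i : Fin d} {c : ℝ}
    (hc : utilityContribution D (unit h X i) (portfolio h X) = (c : EReal)) :
    rarocContribution P D (unit h X i) (portfolio h X) =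
      ((h i * meanVector X P i / -c : ℝ) : EReal) := by
  rw [rarocContribution, riskContribution, hc, expect_unit (hX P hP), ← EReal.coe_neg,
    EReal.coe_div]

theorem riskContribution_eq_zero_iff {Y Z : Ω → ℝ} {c : ℝ}
    (hc : utilityContribution D Z Y = (c : EReal)) : riskContribution D Z Y = 0 ↔ c = 0 := by
  rw [riskContribution, hc, ← EReal.coe_neg, EReal.coe_eq_zero, neg_eq_zero]

theorem meanVector_mem_generator (hX : ∀ Q ∈ D, ∀ i, Integrable (X i) Q) (hP : P ∈ D) :
    meanVector X P ∈ generator D X := by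
  rw [generator_eq_closure_image hX]
  exact subset_closure ⟨P, hP, rfl⟩

theorem optimalRaroc_eq_of_mem_rarocArgmax {H : Set (EuclideanSpace ℝ (Fin d))}
    {h : EuclideanSpace ℝ (Fin d)} (hh : h ∈ rarocArgmax P D X H) :
    optimalRaroc P D X H = raroc P D (portfolio h X) :=
  le_antisymm (iSup₂_le hh.2) (le_iSup₂_of_le h hh.1 le_rfl)

/-- If `-R x` is the mean vector for some `R > 0`, where `x` is the worst-case vector of the
portfolio `h`, then `h` has the greatest RAROC among all portfolios, and this RAROC is `R`. -/
theorem raroc_le_and_eq_of_mean_eq (hX : ∀ Q ∈ D, ∀ i, Integrable (X i) Q)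
    (hG : IsCompact (generator D X)) (hP : P ∈ D) {h x : EuclideanSpace ℝ (Fin d)}
    (hx : x ∈ generator D X) (hmin : ∀ y ∈ generator D X, inner ℝ h x ≤ inner ℝ h y)
    (huniq : ∀ y ∈ generator D X, inner ℝ h y = inner ℝ h x → y = x) {R : ℝ} (hR : 0 < R)
    (hmean : meanVector X P = -R • x) (hne : meanVector X P ≠ 0) :
    (∀ g, raroc P D (portfolio g X) ≤ R) ∧ raroc P D (portfolio h X) = R := by
  have hmem := meanVector_mem_generator hX hP
  have hinner : ∀ g : EuclideanSpace ℝ (Fin d),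
      inner ℝ g (meanVector X P) = -R * inner ℝ g x := fun g => by
    rw [hmean, real_inner_smul_right]
  have hneg : inner ℝ h x < 0 := by
    have h1 := hmin _ hmem
    rw [hinner] at h1
    -- Otherwise `⟨h, x⟩ = 0 = ⟨h, m⟩`, so `m` is also a minimiser and `m = x = -R x`, contradicting
    -- `m ≠ 0`.
    by_contra! h2
    have h3 : inner ℝ h x = 0 := by nlinarith
    have h4 := huniq _ hmem (by rw [hinner, h3, mul_zero])
    have h5 : (1 + R) • x = 0 := by
      rw [add_smul, one_smul]
      nth_rw 1 [← h4]
      rw [hmean, neg_smul, neg_add_cancel]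
    rcases smul_eq_zero.1 h5 with h6 | h6
    · linarith
    · exact hne (by rw [hmean, h6, smul_zero])
  constructor
  · intro g
    obtain ⟨y, hy, hymin⟩ := hG.exists_isMinOn ⟨x, hx⟩
      (f := fun y => (inner ℝ g y : ℝ)) (by fun_prop)
    have h1 : inner ℝ g y ≤ inner ℝ g x := hymin hx
    have h2 : inner ℝ g y ≤ inner ℝ g (meanVector X P) := hymin hmem
    rw [raroc_portfolio hX hP hy (fun z hz => hymin hz) fun hpos => by
      rw [hinner] at hpos; nlinarith, EReal.coe_le_coe_iff]
    rw [hinner] at h2 ⊢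
    -- A positive minimum is impossible: `⟨g, x⟩` and `⟨g, m⟩ = -R⟨g, x⟩` cannot both be positive.
    rcases lt_trichotomy (inner ℝ g y) 0 with h3 | h3 | h3
    · rw [div_le_iff₀ (by linarith)]
      nlinarith
    · simp [h3, hR.le]
    · nlinarith
  · rw [raroc_portfolio hX hP hx hmin fun _ => hneg, hinner, EReal.coe_eq_coe_iff, neg_mul,
      neg_div_neg_eq, mul_div_cancel_right₀ _ hneg.ne]

theorem mean_eq_of_rarocContribution_eq {h x m : EuclideanSpace ℝ (Fin d)} {R : ℝ}
    (hne : ∀ i, h i * x i ≠ 0) (hR : ∀ i, h i * m i / -(h i * x i) = R) : m = -R • x := by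
  ext i
  have h1 := hR i
  rw [div_eq_iff (neg_ne_zero.2 (hne i))] at h1
  refine mul_left_cancel₀ (left_ne_zero_of_mul (hne i)) ?_
  simp only [PiLp.smul_apply, smul_eq_mul]
  linarith

/-- For small `t > 0`, `-t g = a + b` with `a ∈ G` and `b ∈ H*`; pairing with `g` gives `⟨g, a⟩ ≤
-t‖g‖² < 0`. -/
theorem inner_neg_of_mem_interior_add_dualCone {G H : Set (EuclideanSpace ℝ (Fin d))}
    (h0 : (0 : EuclideanSpace ℝ (Fin d)) ∈ interior (G + dualCone H))
    {g y : EuclideanSpace ℝ (Fin d)} (hg : g ∈ H) (hg0 : g ≠ 0)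
    (hmin : ∀ z ∈ G, inner ℝ g y ≤ inner ℝ g z) : inner ℝ g y < 0 := by
  have hlim : Filter.Tendsto (fun t : ℝ => -t • g) (nhdsWithin 0 (Set.Ioi 0)) (nhds 0) := by
    have : Continuous fun t : ℝ => -t • g := by fun_prop
    simpa using (this.tendsto 0).mono_left nhdsWithin_le_nhds
  obtain ⟨t, htK, ht⟩ := ((hlim.eventually (mem_interior_iff_mem_nhds.1 h0)).and
    self_mem_nhdsWithin).exists
  obtain ⟨a, ha, b, hb, hab⟩ := htK
  have h1 := congrArg (fun z => (inner ℝ g z : ℝ)) hab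
  simp only [inner_add_right, inner_smul_right] at h1
  have h2 : 0 < t * inner ℝ g g := mul_pos ht (real_inner_self_pos.2 hg0)
  have h3 := hmin a ha
  have h4 : (0 : ℝ) ≤ inner ℝ g b := hb g hg
  linarith

/-- First-order condition: if `⟨g, m⟩ + R min_G ⟨g, ·⟩ ≤ 0` for `g` near `h`, with equality at
`h`, then `m = -R x`, where `x` is the unique minimiser of `⟨h, ·⟩` on `G`. -/
theorem eq_neg_smul_of_eventually_le {G : Set (EuclideanSpace ℝ (Fin d))} (hG : IsCompact G)
    {h x m : EuclideanSpace ℝ (Fin d)} (hx : x ∈ G)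
    (hmin : ∀ y ∈ G, inner ℝ h x ≤ inner ℝ h y)
    (huniq : ∀ y ∈ G, inner ℝ h y = inner ℝ h x → y = x) {R : ℝ}
    (heq : inner ℝ h m + R * inner ℝ h x = 0)
    (hle : ∀ᶠ g in nhds h, ∀ y ∈ G, (∀ z ∈ G, inner ℝ g y ≤ inner ℝ g z) →
      inner ℝ g m + R * inner ℝ g y ≤ 0) : m = -R • x := by
  -- Taking `v = m + R • x` afterwards forces this vector to vanish.
  have hdir : ∀ v : EuclideanSpace ℝ (Fin d), inner ℝ v (m + R • x) ≤ (0 : ℝ) := by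
    intro v
    refine le_of_forall_pos_le_add fun ε hε => ?_
    have hε' : 0 < ε / (|R| + 1) := by positivity
    obtain ⟨δ, hδ, hbound⟩ := exists_inner_add_smul_lower_bound hG hmin huniq v hε'
    have hlim : Filter.Tendsto (fun t : ℝ => h + t • v) (nhdsWithin 0 (Set.Ioi 0)) (nhds h) := by
      have : Continuous fun t : ℝ => h + t • v := by fun_prop
      simpa using (this.tendsto 0).mono_left nhdsWithin_le_nhds
    obtain ⟨t, ⟨hle', htδ⟩, ht⟩ := (((hlim.eventually hle).and
      (nhdsWithin_le_nhds (Iic_mem_nhds hδ))).and self_mem_nhdsWithin).exists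
    have ht : 0 < t := ht
    obtain ⟨y, hy, hymin⟩ := hG.exists_isMinOn ⟨x, hx⟩
      (f := fun y => (inner ℝ (h + t • v) y : ℝ)) (by fun_prop)
    have h1 := hle' y hy fun z hz => hymin hz
    have h2 : inner ℝ (h + t • v) y ≤ inner ℝ (h + t • v) x := hymin hx
    have h3 := hbound t ht htδ y hy
    simp only [inner_add_left, real_inner_smul_left] at h1 h2
    rw [inner_add_right, real_inner_smul_right, zero_add]
    refine le_of_mul_le_mul_left ?_ ht
    -- The sign of `R` decides whether the minimum at `h + t v` must be bounded below (rate
    -- estimate) or above (its value at `x`).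
    rcases le_total 0 R with hR | hR
    · have h4 : R * (ε / (|R| + 1)) ≤ ε := by
        rw [abs_of_nonneg hR, mul_div_assoc', div_le_iff₀ (by linarith)]
        nlinarith
      have h5 := mul_le_mul_of_nonneg_left h3 hR
      have h6 := mul_le_mul_of_nonneg_left h4 ht.le
      linarith
    · have h5 := mul_le_mul_of_nonpos_left h2 hR
      have h6 := mul_pos ht hε
      linarith
  have h1 : m + R • x = 0 :=
    inner_self_eq_zero.1 (le_antisymm (hdir (m + R • x)) real_inner_self_nonneg)
  rw [neg_smul]
  exact eq_neg_of_add_eq_zero_left h1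

theorem le_of_div_neg_le {e u R : ℝ} (hu : u < 0) (h : e / -u ≤ R) : e + R * u ≤ 0 := by
  rw [div_le_iff₀ (by linarith)] at h
  linarith

end Contribution

end CoherentRisk

theorem mainTheorem12 {Ω : Type*} [MeasurableSpace Ω] (P : Measure Ω) [IsProbabilityMeasure P]
    (D : Set (Measure Ω)) (hD : ∀ Q ∈ D, IsProbabilityMeasure Q ∧ Q ≪ P)
    (hDconv : Convex ℝ≥0 D) (hPD : P ∈ D)
    {d : ℕ} (X : Fin d → Ω → ℝ) (hX : ∀ i, CoherentRisk.MemWeakL1 P D (X i))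
    (H : ConvexCone ℝ (EuclideanSpace ℝ (Fin d)))
    (hmean : ∃ i, CoherentRisk.expect P (X i) ≠ 0)
    (hG : CoherentRisk.IsStrictlyConvexBody (CoherentRisk.generator D X))
    (h : EuclideanSpace ℝ (Fin d)) :
    (h ∈ H →
      (∀ i, CoherentRisk.riskContribution D (CoherentRisk.unit h X i)
        (CoherentRisk.portfolio h X) ≠ 0) →
      (∀ i j, CoherentRisk.rarocContribution P D (CoherentRisk.unit h X i)
          (CoherentRisk.portfolio h X) =
        CoherentRisk.rarocContribution P D (CoherentRisk.unit h X j)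
          (CoherentRisk.portfolio h X)) →
      (∀ i, 0 ≤ CoherentRisk.rarocContribution P D (CoherentRisk.unit h X i)
        (CoherentRisk.portfolio h X)) →
      h ∈ CoherentRisk.rarocArgmax P D X H ∧
        ∀ i, CoherentRisk.rarocContribution P D (CoherentRisk.unit h X i)
          (CoherentRisk.portfolio h X) = CoherentRisk.optimalRaroc P D X H) ∧
    ((0 : EuclideanSpace ℝ (Fin d)) ∈ intrinsicInterior ℝ
        (CoherentRisk.generator D X + CoherentRisk.dualCone (H : Set (EuclideanSpace ℝ (Fin d)))) →
      h ∈ interior (H : Set (EuclideanSpace ℝ (Fin d))) →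
      h ∈ CoherentRisk.rarocArgmax P D X H →
      ∀ i,
        (CoherentRisk.riskContribution D (CoherentRisk.unit h X i)
            (CoherentRisk.portfolio h X) ≠ 0 →
          CoherentRisk.rarocContribution P D (CoherentRisk.unit h X i)
            (CoherentRisk.portfolio h X) = CoherentRisk.optimalRaroc P D X H) ∧
        (CoherentRisk.riskContribution D (CoherentRisk.unit h X i)
            (CoherentRisk.portfolio h X) = 0 →
          CoherentRisk.expect P (CoherentRisk.unit h X i) = 0)) := by
  have hDac : ∀ Q ∈ D, Q ≪ P := fun Q hQ => (hD Q hQ).2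
  have hint : ∀ Q ∈ D, ∀ i, Integrable (X i) Q :=
    fun Q hQ i => (hX i).integrable hQ (hDac Q hQ)
  have hGc := CoherentRisk.isCompact_generator hDac hX
  have hGconv : Convex ℝ (CoherentRisk.generator D X) := by
    rw [CoherentRisk.generator_eq_closure_image hint]
    exact (CoherentRisk.convex_image_meanVector hDconv hint).closure
  have hPmem := CoherentRisk.meanVector_mem_generator hint hPD
  set m := CoherentRisk.meanVector X P with hm
  obtain ⟨i₀, hi₀⟩ := hmean
  have hm0 : m ≠ 0 := by
    intro h0
    apply hi₀
    rw [CoherentRisk.expect_eq_integral (hint P hPD i₀), EReal.coe_eq_zero]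
    exact congrArg (fun v : EuclideanSpace ℝ (Fin d) => v i₀) h0
  obtain ⟨x, hx, hxmin⟩ := hGc.exists_isMinOn ⟨m, hPmem⟩
    (f := fun y => (inner ℝ h y : ℝ)) (by fun_prop)
  have hmin : ∀ y ∈ CoherentRisk.generator D X, inner ℝ h x ≤ inner ℝ h y := fun y hy => hxmin hy
  have hzero := CoherentRisk.utilityContribution_unit_zero hint hGc ⟨m, hPmem⟩
  have huniq : h ≠ 0 → ∀ y ∈ CoherentRisk.generator D X, inner ℝ h y = inner ℝ h x → y = x :=
    fun hh y hy hxy => CoherentRisk.eq_of_isMin_inner hGconv hG.2 hh hx hy hmin hxy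
  have hcontr : ∀ i, CoherentRisk.utilityContribution D (CoherentRisk.unit h X i)
      (CoherentRisk.portfolio h X) = ((h i * x i : ℝ) : EReal) := by
    intro i
    by_cases hh : h = 0
    · subst hh
      rw [hzero i]
      simp
    · exact CoherentRisk.utilityContribution_unit hint hGc hx hmin (huniq hh) i
  simp only [ne_eq, CoherentRisk.riskContribution_eq_zero_iff (hcontr _),
    CoherentRisk.rarocContribution_unit hint hPD (hcontr _), CoherentRisk.expect_unit (hint P hPD),
    EReal.coe_eq_coe_iff, EReal.coe_nonneg, EReal.coe_eq_zero, ← hm]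
  constructor
  · intro hH hne heq hnonneg
    have hh : h ≠ 0 := by
      rintro rfl
      exact hne i₀ (by simp)
    have hmR := CoherentRisk.mean_eq_of_rarocContribution_eq hne fun i => heq i i₀
    have hR : 0 < h i₀ * m i₀ / -(h i₀ * x i₀) := by
      refine lt_of_le_of_ne (hnonneg i₀) fun h0 => hm0 ?_
      rw [hmR, ← h0, neg_zero, zero_smul]
    obtain ⟨hle, hval⟩ := CoherentRisk.raroc_le_and_eq_of_mean_eq hint hGc hPD hx hmin (huniq hh)
      hR hmR hm0
    have harg : h ∈ CoherentRisk.rarocArgmax P D X H :=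
      ⟨hH, fun g _ => (hle g).trans hval.ge⟩
    refine ⟨harg, fun i => ?_⟩
    rw [CoherentRisk.optimalRaroc_eq_of_mem_rarocArgmax harg, hval, heq i i₀]
  · intro h0 hint_h harg i
    by_cases hh : h = 0
    · subst hh
      simp
    have hsub : CoherentRisk.generator D X ⊆ CoherentRisk.generator D X +
        CoherentRisk.dualCone (H : Set (EuclideanSpace ℝ (Fin d))) :=
      fun y hy => ⟨y, hy, 0, fun g _ => by simp, add_zero y⟩
    have h0' := CoherentRisk.mem_interior_of_mem_intrinsicInterior
      (hG.1.mono (interior_mono hsub)) h0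
    have hneg := CoherentRisk.inner_neg_of_mem_interior_add_dualCone h0' harg.1 hh hmin
    have hval := CoherentRisk.raroc_portfolio hint hPD hx hmin fun _ => hneg
    rw [← hm] at hval
    -- The multiplier is the RAROC of `h` itself, so equality at `h` is automatic.
    have hmR : m = -(inner ℝ h m / -inner ℝ h x) • x := by
      refine CoherentRisk.eq_neg_smul_of_eventually_le hGc hx hmin (huniq hh) ?_ ?_
      · field_simp [hneg.ne]
        ring
      · filter_upwards [mem_interior_iff_mem_nhds.1 hint_h] with g hg y hy hymin
        by_cases hg0 : g = 0
        · simp [hg0]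
        have hgneg := CoherentRisk.inner_neg_of_mem_interior_add_dualCone h0' hg hg0 hymin
        have hle := harg.2 g hg
        rw [hval, CoherentRisk.raroc_portfolio hint hPD hy hymin fun _ => hgneg,
          EReal.coe_le_coe_iff] at hle
        exact CoherentRisk.le_of_div_neg_le hgneg hle
    have hmi : h i * m i = -(inner ℝ h m / -inner ℝ h x) * (h i * x i) := by
      have := congrArg (fun v : EuclideanSpace ℝ (Fin d) => v i) hmR
      simp only [PiLp.smul_apply, smul_eq_mul] at this
      rw [this]
      ring
    refine ⟨fun hne => ?_, fun hz => by rw [hmi, hz, mul_zero]⟩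
    rw [CoherentRisk.optimalRaroc_eq_of_mem_rarocArgmax harg, hval, EReal.coe_eq_coe_iff,
      div_eq_iff (neg_ne_zero.2 hne), hmi]
    ring
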